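/- Let $X_1,X_2,X_3$ be zero-mean jointly Gaussian random vectors in $\mathbb{R}^T$, $T\ge 1$, whose joint law has a density (equivalently, whose joint $3T\times 3T$ covariance matrix is nonsingular). For nonempty $s\subseteq\{1,2,3\}$ let $X_s=(X_i)_{i\in s}$, let $f_{X_s}$ be its density, and let $$\underline{h}_s=\frac1T\,h(X_s)=-\frac1T\int f_{X_s}(x)\log f_{X_s}(x)\,dx .$$ The vector $\underline{h}=(\underline{h}_s)_{\emptyset\ne s\subseteq\{1,2,3\}}\in\mathbb{R}^7$ is called the normalized entropy vector of $X_1,X_2,X_3$. **Theorem.** Let $\mathcal V\subset\mathbb{R}^7$ be the set of all normalized entropy vectors of three such vector-valued jointly Gaussian random variables, over all dimensions $T\ge 1$, and let $\mathcal S\subset\mathbb{R}^7$ be the set of those that arise with $T=1$, that is, from three scalar jointly Gaussian random variables. Then the closure of $\mathcal V$ equals the closure of the convex hull of $\mathcal S$: $$\overline{\mathcal V}=\overline{\operatorname{conv}(\mathcal S)} .$$ -/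

import Mathlib

open MeasureTheory ProbabilityTheory

/-- The differential entropy `-∫ f log f` of a law `ν` with density `f` with respect to the
volume (Lebesgue measure). -/
noncomputable def differentialEntropy {E : Type*} [MeasureSpace E] (ν : Measure E) : ℝ :=
  -∫ x, (ν.rnDeriv volume x).toReal * Real.log (ν.rnDeriv volume x).toReal

/-- The subfamily `X_s = (X_i)_{i ∈ s}`, as one random variable. -/
def subfamily {n : ℕ} {Ω E : Type*} (X : Fin n → Ω → E) (s : Finset (Fin n)) : Ω → (s → E) :=
  fun ω i => X i ω

/-- `X_1, …, X_n` are zero-mean jointly Gaussian random vectors in `ℝ^T`, and their joint law has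
a density (equivalently, their joint covariance matrix is nonsingular, so that all the joint
differential entropies are finite). -/
structure IsJointlyGaussian {n T : ℕ} {Ω : Type*} [MeasurableSpace Ω] (P : Measure Ω)
    (X : Fin n → Ω → (Fin T → ℝ)) : Prop where
  hasGaussianLaw : HasGaussianLaw (fun ω i => X i ω) P
  integral_eq_zero : ∀ i, ∫ ω, X i ω ∂P = 0
  absolutelyContinuous : P.map (fun ω i => X i ω) ≪ volume

/-- The vectors with `2 ^ n - 1` coordinates, one for each nonempty set of indices. -/
abbrev EntropyVector (n : ℕ) : Type := {s : Finset (Fin n) // s.Nonempty} → ℝ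

/-- The entropy vector of `X_1, …, X_n` in `ℝ^T`, normalized by the dimension:
the coordinate at `s` is `h(X_s) / T`. -/
noncomputable def normalizedEntropyVector {n T : ℕ} {Ω : Type*} [MeasurableSpace Ω]
    (P : Measure Ω) (X : Fin n → Ω → (Fin T → ℝ)) : EntropyVector n :=
  fun s => (1 / (T : ℝ)) * differentialEntropy (P.map (subfamily X s.1))

/-- The normalized entropy vectors of all jointly Gaussian `X_1, …, X_n` in `ℝ^T`, for fixed `T`. -/
def gaussianEntropyRegionOfDim (n T : ℕ) : Set (EntropyVector n) :=
  {h | ∃ (Ω : Type) (_ : MeasurableSpace Ω) (P : Measure Ω) (X : Fin n → Ω → (Fin T → ℝ)),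
    IsJointlyGaussian P X ∧ h = normalizedEntropyVector P X}

/-- The normalized entropy region of `n` vector-valued jointly Gaussian random variables, of
arbitrary common dimension `T ≥ 1`. -/
def vectorGaussianEntropyRegion (n : ℕ) : Set (EntropyVector n) :=
  {h | ∃ T : ℕ, 1 ≤ T ∧ h ∈ gaussianEntropyRegionOfDim n T}

/-- The entropy region of `n` scalar jointly Gaussian random variables, `T = 1`. -/
def scalarGaussianEntropyRegion (n : ℕ) : Set (EntropyVector n) :=
  gaussianEntropyRegionOfDim n 1

/-! Both closures equal the cone of vectors that are submodular once extended by 0 at the empty set.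

Upper bound: a nondegenerate Gaussian subfamily has entropy equal to a constant times its dimension
plus half the logarithm of a principal minor of the covariance matrix. The dimension term is modular
and log minors are submodular (`logMinor_union_add_inter_le`), because the ratio of successive
minors is a Schur complement, the minimum of a quadratic form that decreases as more coordinates
become free. The cone is closed and convex, so it contains both closures.

Lower bound: for three indices, every submodular vector is a modular vector minus a nonnegative
combination of five explicit vectors. Modular vectors come from independent scalars. Each of the
five is the rate at which entropy tends to minus infinity along covariances `G + δ • 1` with `G`
singular. Averaging many copies of one scalar vector with one far-out vector per direction leaves an
error that tends to 0 (`sub_sum_mem_closure_scalarAverages`). Such averages are convex combinations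
of scalar vectors, and also vector-valued entropy vectors via block diagonal covariances, so they
lie in both sets. -/

/-! ### Standard Gaussian entropy and change of variables. -/

section Entropy

/-- Currying preserves the Lebesgue measure. -/
theorem measurePreserving_curry (κ τ : Type*) [Fintype κ] [Fintype τ] :
    MeasurePreserving (MeasurableEquiv.curry κ τ ℝ) volume volume := by
  have h : MeasurePreserving (MeasurableEquiv.curry κ τ ℝ).symm volume volume := by
    refine ⟨(MeasurableEquiv.curry κ τ ℝ).symm.measurable, ?_⟩
    symm
    refine Measure.pi_eq fun s hs => ?_
    rw [MeasurableEquiv.map_apply]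
    have : (MeasurableEquiv.curry κ τ ℝ).symm ⁻¹' (Set.univ.pi s) =
        Set.univ.pi fun k => Set.univ.pi fun t => s (k, t) := by
      ext x
      simp [Set.mem_pi, MeasurableEquiv.curry, Function.uncurry]
    rw [this, volume_pi, Measure.pi_pi]
    simp_rw [volume_pi, Measure.pi_pi]
    rw [Fintype.prod_prod_type]
  exact h.symm

/-- The standard Gaussian measure on `ℝ^ι` has density the product of the standard densities. -/
theorem pi_gaussianReal_eq_withDensity (ι : Type*) [Fintype ι] :
    Measure.pi (fun _ : ι => gaussianReal 0 1) =
      volume.withDensity fun x : ι → ℝ => ENNReal.ofReal (∏ i, gaussianPDFReal 0 1 (x i)) := by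
  refine Measure.pi_eq fun s hs => ?_
  rw [withDensity_apply _ (MeasurableSet.univ_pi hs), volume_pi, Measure.restrict_pi_pi,
    ← ofReal_integral_eq_lintegral_ofReal]
  · rw [integral_fintype_prod_eq_prod, ENNReal.ofReal_prod_of_nonneg]
    · refine Finset.prod_congr rfl fun i _ => ?_
      rw [gaussianReal_apply_eq_integral _ one_ne_zero]
    · exact fun i _ => integral_nonneg fun x => gaussianPDFReal_nonneg _ _ _
  · exact Integrable.fintype_prod fun i => (integrable_gaussianPDFReal 0 1).integrableOn
  · exact Filter.Eventually.of_forall fun x =>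
      Finset.prod_nonneg fun i _ => gaussianPDFReal_nonneg _ _ _

/-- The change of the differential entropy under a map that scales the volume. -/
theorem differentialEntropy_map_equiv {A E : Type*} [MeasureSpace A] [MeasureSpace E]
    [SigmaFinite (volume : Measure E)] {μ : Measure A} [IsProbabilityMeasure μ] {g : A → ℝ}
    (hg : Measurable g) (hg0 : ∀ x, 0 < g x)
    (hμ : μ = volume.withDensity fun x => ENNReal.ofReal (g x))
    (hint : Integrable (fun x => Real.log (g x)) μ) (L : A ≃ᵐ E) {c : ℝ} (hc : 0 < c)
    (hL : volume.map L = ENNReal.ofReal c • volume) :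
    differentialEntropy (μ.map L) = -(∫ x, Real.log (g x) ∂μ) - Real.log c := by
  have hmeas : Measurable fun y => ENNReal.ofReal (c * g (L.symm y)) := by fun_prop
  have hmap : μ.map L = volume.withDensity fun y => ENNReal.ofReal (c * g (L.symm y)) := by
    ext s hs
    rw [MeasurableEquiv.map_apply, hμ, withDensity_apply _ (L.measurable hs),
      withDensity_apply _ hs]
    have h1 : ∫⁻ y in s, ENNReal.ofReal (g (L.symm y)) ∂(volume.map L) =
        ∫⁻ x in L ⁻¹' s, ENNReal.ofReal (g x) := by
      rw [MeasurableEquiv.restrict_map, lintegral_map_equiv]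
      simp
    rw [← h1, hL, Measure.restrict_smul, lintegral_smul_measure, smul_eq_mul,
      ← lintegral_const_mul _ (by fun_prop)]
    simp_rw [ENNReal.ofReal_mul hc.le]
  have hrn : (μ.map L).rnDeriv volume =ᵐ[volume] fun y => ENNReal.ofReal (c * g (L.symm y)) := by
    rw [hmap]
    exact Measure.rnDeriv_withDensity _ hmeas
  have hpos : ∀ y, 0 < c * g (L.symm y) := fun y => mul_pos hc (hg0 _)
  -- The integral of f log f is the mean of log f under the law itself, so it can be pulled back
  -- along `L`.
  have h2 : ∫ y, ((μ.map L).rnDeriv volume y).toReal *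
      Real.log ((μ.map L).rnDeriv volume y).toReal =
      ∫ y, Real.log (c * g (L.symm y)) ∂(μ.map L) := by
    rw [hmap, integral_withDensity_eq_integral_toReal_smul hmeas (by simp), ← hmap]
    refine integral_congr_ae ?_
    filter_upwards [hrn] with y hy
    rw [hy, ENNReal.toReal_ofReal (hpos y).le, smul_eq_mul]
  rw [differentialEntropy, h2, integral_map_equiv]
  simp only [MeasurableEquiv.symm_apply_apply]
  have h3 : ∀ x, Real.log (c * g x) = Real.log c + Real.log (g x) := fun x =>
    Real.log_mul hc.ne' (hg0 x).ne'
  simp_rw [h3]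
  rw [integral_add (integrable_const _) hint]
  simp
  ring

/-- The differential entropy of the standard Gaussian law on `ℝ`. -/
noncomputable def stdEntropy : ℝ := -∫ x, Real.log (gaussianPDFReal 0 1 x) ∂(gaussianReal 0 1)

theorem integrable_log_gaussianPDFReal :
    Integrable (fun x => Real.log (gaussianPDFReal 0 1 x)) (gaussianReal 0 1) := by
  have h : ∀ x, Real.log (gaussianPDFReal 0 1 x) =
      Real.log (√(2 * Real.pi * (1 : NNReal)))⁻¹ + -(1 / 2) * x ^ 2 := by
    intro x
    rw [gaussianPDFReal, Real.log_mul (by positivity) (Real.exp_pos _).ne', Real.log_exp]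
    simp
    ring
  simp_rw [h]
  exact (integrable_const _).add
    ((memLp_id_gaussianReal (μ := 0) (v := 1) 2).integrable_sq.const_mul _)

theorem log_prod_gaussianPDFReal {ι : Type*} [Fintype ι] (x : ι → ℝ) :
    Real.log (∏ i, gaussianPDFReal 0 1 (x i)) = ∑ i, Real.log (gaussianPDFReal 0 1 (x i)) :=
  Real.log_prod fun i _ => (gaussianPDFReal_pos 0 1 (x i) one_ne_zero).ne'

theorem integrable_log_gaussianPDFReal_eval {ι : Type*} [Fintype ι] (i : ι) :
    Integrable (fun x : ι → ℝ => Real.log (gaussianPDFReal 0 1 (x i)))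
      (Measure.pi fun _ => gaussianReal 0 1) :=
  integrable_comp_eval (μ := fun _ : ι => gaussianReal 0 1)
    (f := fun y => Real.log (gaussianPDFReal 0 1 y)) integrable_log_gaussianPDFReal

theorem integrable_log_prod_gaussianPDFReal (ι : Type*) [Fintype ι] :
    Integrable (fun x : ι → ℝ => Real.log (∏ i, gaussianPDFReal 0 1 (x i)))
      (Measure.pi fun _ => gaussianReal 0 1) := by
  simp_rw [log_prod_gaussianPDFReal]
  exact integrable_finsetSum _ fun i _ => integrable_log_gaussianPDFReal_eval i

theorem integral_log_prod_gaussianPDFReal (ι : Type*) [Fintype ι] :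
    ∫ x : ι → ℝ, Real.log (∏ i, gaussianPDFReal 0 1 (x i)) ∂(Measure.pi fun _ => gaussianReal 0 1)
      = -(Fintype.card ι * stdEntropy) := by
  simp_rw [log_prod_gaussianPDFReal]
  rw [integral_finsetSum _ fun i _ => integrable_log_gaussianPDFReal_eval i]
  have : ∀ i : ι, ∫ x : ι → ℝ, Real.log (gaussianPDFReal 0 1 (x i))
      ∂(Measure.pi fun _ => gaussianReal 0 1) = -stdEntropy := fun i => by
    rw [stdEntropy, neg_neg]
    exact integral_comp_eval (μ := fun _ : ι => gaussianReal 0 1)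
      (f := fun y => Real.log (gaussianPDFReal 0 1 y)) integrable_log_gaussianPDFReal.aestronglyMeasurable
  simp [this]

end Entropy

/-! ### Centered Gaussian laws and their covariance matrices. -/

section Law

variable {κ τ : Type*} [Fintype κ] [Fintype τ]

theorem memLp_eval {ν : Measure (κ → τ → ℝ)} [IsGaussian ν] (k : κ) (t : τ) :
    MemLp (fun x => x k t) 2 ν :=
  IsGaussian.memLp_dual ν (ContinuousLinearMap.proj (R := ℝ) (φ := fun _ : τ => ℝ) t ∘L
    ContinuousLinearMap.proj (R := ℝ) (φ := fun _ : κ => τ → ℝ) k) 2 (by simp)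

/-- The covariance matrix of a law on `κ → ℝ^τ`. -/
noncomputable def covMatrix (ν : Measure (κ → τ → ℝ)) : Matrix (κ × τ) (κ × τ) ℝ :=
  Matrix.of fun a b => cov[fun x => x a.1 a.2, fun x => x b.1 b.2; ν]

theorem covariance_sum_mul_eval {ν : Measure (κ → τ → ℝ)} [IsGaussian ν] (u v : κ × τ → ℝ) :
    cov[fun x => ∑ a, u a * x a.1 a.2, fun x => ∑ b, v b * x b.1 b.2; ν] =
      u ⬝ᵥ (covMatrix ν).mulVec v := by
  have h := covariance_fun_sum_fun_sum (μ := ν) (X := fun (a : κ × τ) x => u a * x a.1 a.2)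
    (Y := fun (b : κ × τ) x => v b * x b.1 b.2) (fun a => (memLp_eval a.1 a.2).const_mul _)
    fun b => (memLp_eval b.1 b.2).const_mul _
  rw [h]
  simp_rw [covariance_const_mul_left, covariance_const_mul_right]
  simp [dotProduct, Matrix.mulVec, covMatrix, Finset.mul_sum, mul_comm]

variable [DecidableEq κ] [DecidableEq τ]

/-- The centered Gaussian law on `κ → ℝ^τ` with covariance matrix `S`. -/
noncomputable def gaussianLaw (S : Matrix (κ × τ) (κ × τ) ℝ) : Measure (κ → τ → ℝ) :=
  (multivariateGaussian 0 S).map fun x k t => x (k, t)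

instance (S : Matrix (κ × τ) (κ × τ) ℝ) : IsGaussian (gaussianLaw S) := by
  let L : EuclideanSpace ℝ (κ × τ) →L[ℝ] (κ → τ → ℝ) :=
    ContinuousLinearMap.pi fun k => ContinuousLinearMap.pi fun t => EuclideanSpace.proj (k, t)
  have : gaussianLaw S = (multivariateGaussian 0 S).map L := rfl
  rw [this]
  infer_instance

theorem integral_eval_gaussianLaw (S : Matrix (κ × τ) (κ × τ) ℝ) (k : κ) (t : τ) :
    ∫ x, x k t ∂(gaussianLaw S) = 0 := by
  rw [gaussianLaw, integral_map (Measurable.aemeasurable (by fun_prop))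
    (Measurable.aestronglyMeasurable (by fun_prop))]
  have := (EuclideanSpace.proj (k, t) : EuclideanSpace ℝ (κ × τ) →L[ℝ] ℝ).integral_comp_id_comm
    (μ := multivariateGaussian 0 S) IsGaussian.integrable_id
  rw [integral_id_multivariateGaussian] at this
  simpa using this

theorem covariance_eval_gaussianLaw {S : Matrix (κ × τ) (κ × τ) ℝ} (hS : S.PosSemidef)
    (a b : κ × τ) :
    cov[fun x => x a.1 a.2, fun x => x b.1 b.2; gaussianLaw S] = S a b := by
  rw [gaussianLaw, covariance_map_fun (Measurable.aestronglyMeasurable (by fun_prop))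
    (Measurable.aestronglyMeasurable (by fun_prop)) (Measurable.aemeasurable (by fun_prop))]
  exact covariance_eval_multivariateGaussian hS a b

theorem dual_apply_eq_sum (L : StrongDual ℝ (κ → τ → ℝ)) (x : κ → τ → ℝ) :
    L x = ∑ a : κ × τ, L (Pi.single a.1 (Pi.single a.2 1)) * x a.1 a.2 := by
  have h : x = ∑ a : κ × τ, x a.1 a.2 • (Pi.single a.1 (Pi.single a.2 1) : κ → τ → ℝ) := by
    ext k t
    simp [Fintype.sum_prod_type, Finset.sum_apply, Pi.single_apply, apply_ite, ite_apply,
      Finset.sum_ite_eq]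
  conv_lhs => rw [h]
  simp [map_sum, mul_comm]

/-- A centered Gaussian law is determined by its covariance matrix. -/
theorem eq_gaussianLaw {ν : Measure (κ → τ → ℝ)} [IsGaussian ν]
    (h0 : ∀ k t, ∫ x, x k t ∂ν = 0) (hS : (covMatrix ν).PosSemidef) :
    ν = gaussianLaw (covMatrix ν) := by
  have hcov : covMatrix (gaussianLaw (covMatrix ν)) = covMatrix ν := by
    ext a b
    exact covariance_eval_gaussianLaw hS a b
  -- The characteristic function of a Gaussian law at `L` depends only on the mean and variance of
  -- `L`; the variance is a quadratic form in the covariance matrix.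
  apply Measure.ext_of_charFunDual
  ext L
  have hL : ⇑L = fun x => ∑ a : κ × τ, L (Pi.single a.1 (Pi.single a.2 1)) * x a.1 a.2 :=
    funext (dual_apply_eq_sum L)
  have hvar : Var[L; ν] = Var[L; gaussianLaw (covMatrix ν)] := by
    rw [← covariance_self (by fun_prop), ← covariance_self (by fun_prop), hL,
      covariance_sum_mul_eval, covariance_sum_mul_eval, hcov]
  have hmean : ∀ ρ : Measure (κ → τ → ℝ), IsGaussian ρ → (∀ k t, ∫ x, x k t ∂ρ = 0) →
      ∫ x, L x ∂ρ = 0 := by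
    intro ρ hρ h
    rw [hL, integral_finsetSum _ fun a _ =>
      ((memLp_eval a.1 a.2).integrable (by norm_num)).const_mul _]
    simp_rw [integral_const_mul, h]
    simp
  rw [IsGaussian.charFunDual_eq, IsGaussian.charFunDual_eq, hvar, integral_complex_ofReal,
    integral_complex_ofReal, hmean _ inferInstance h0,
    hmean _ inferInstance (integral_eval_gaussianLaw _)]

end Law

/-! ### Entropy and nondegeneracy of Gaussian laws. -/

section LawEntropy

open scoped MatrixOrder Matrix.Norms.L2Operator

variable {κ τ : Type*} [Fintype κ] [Fintype τ] [DecidableEq κ] [DecidableEq τ]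

theorem det_sqrt_sq {ι : Type*} [Fintype ι] [DecidableEq ι] {S : Matrix ι ι ℝ}
    (hS : S.PosSemidef) : (CFC.sqrt S).det ^ 2 = S.det := by
  rw [sq, ← Matrix.det_mul, CFC.sqrt_mul_sqrt_self _ hS.nonneg]

/-- A nondegenerate Gaussian law is the image of the standard Gaussian law under a linear
bijection whose determinant is the square root of the determinant of the covariance matrix. -/
theorem exists_map_eq_gaussianLaw {S : Matrix (κ × τ) (κ × τ) ℝ} (hS : S.PosDef) :
    ∃ L : (κ × τ → ℝ) ≃ᵐ (κ → τ → ℝ),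
      gaussianLaw S = (Measure.pi fun _ => gaussianReal 0 1).map L ∧
      volume.map L = ENNReal.ofReal |(CFC.sqrt S).det⁻¹| • volume := by
  have hdet : (CFC.sqrt S).det ≠ 0 := by
    intro h
    have := det_sqrt_sq hS.posSemidef
    rw [h] at this
    exact hS.det_pos.ne (by simpa using this)
  let e : (κ × τ → ℝ) ≃ᵐ (κ × τ → ℝ) := (Matrix.toLinearEquiv' (CFC.sqrt S)
    (Matrix.invertibleOfIsUnitDet _ hdet.isUnit)).toContinuousLinearEquiv.toHomeomorph.toMeasurableEquiv
  have he : ⇑e = Matrix.toLin' (CFC.sqrt S) := rfl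
  refine ⟨e.trans (MeasurableEquiv.curry κ τ ℝ), ?_, ?_⟩
  · rw [gaussianLaw, multivariateGaussian, ← map_pi_eq_stdGaussian,
      Measure.map_map (by fun_prop) (by fun_prop), Measure.map_map (by fun_prop) (by fun_prop)]
    congr 1
    ext z k t
    simp [he, Function.curry, MeasurableEquiv.curry]
  · rw [MeasurableEquiv.coe_trans, ← Measure.map_map (MeasurableEquiv.measurable _) e.measurable,
      he, Real.map_matrix_volume_pi_eq_smul_volume_pi hdet, Measure.map_smul,
      (measurePreserving_curry κ τ).map_eq]

theorem absolutelyContinuous_gaussianLaw {S : Matrix (κ × τ) (κ × τ) ℝ} (hS : S.PosDef) :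
    gaussianLaw S ≪ volume := by
  obtain ⟨L, h1, h2⟩ := exists_map_eq_gaussianLaw hS
  have h3 : (Measure.pi fun _ : κ × τ => gaussianReal 0 1) ≪ volume := by
    rw [pi_gaussianReal_eq_withDensity]
    exact withDensity_absolutelyContinuous _ _
  rw [h1]
  refine (h3.map L.measurable).trans ?_
  rw [h2]
  exact Measure.smul_absolutelyContinuous

/-- The linear map by `CFC.sqrt S` shifts entropy by the logarithm of its determinant. The value of
`stdEntropy` is never needed, since it only multiplies the dimension. -/
theorem differentialEntropy_gaussianLaw {S : Matrix (κ × τ) (κ × τ) ℝ} (hS : S.PosDef) :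
    differentialEntropy (gaussianLaw S) =
      Fintype.card κ * Fintype.card τ * stdEntropy + Real.log S.det / 2 := by
  obtain ⟨L, h1, h2⟩ := exists_map_eq_gaussianLaw hS
  have hd := det_sqrt_sq hS.posSemidef
  have hdet : (CFC.sqrt S).det ≠ 0 := by
    intro h
    rw [h] at hd
    exact hS.det_pos.ne (by simpa using hd)
  have hg : Measurable fun x : κ × τ → ℝ => ∏ i, gaussianPDFReal 0 1 (x i) :=
    Finset.measurable_fun_prod _ fun i _ =>
      (measurable_gaussianPDFReal 0 1).comp (measurable_pi_apply i)
  have key := differentialEntropy_map_equiv hg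
    (fun x => Finset.prod_pos fun i _ => gaussianPDFReal_pos _ _ _ one_ne_zero)
    (pi_gaussianReal_eq_withDensity _) (integrable_log_prod_gaussianPDFReal _) L
    (abs_pos.2 (inv_ne_zero hdet)) h2
  rw [h1, key, integral_log_prod_gaussianPDFReal, Real.log_abs, Real.log_inv, ← hd, Real.log_pow,
    Fintype.card_prod]
  push_cast
  ring

/-- The covariance matrix of an absolutely continuous Gaussian law is positive definite. -/
theorem posDef_covMatrix {ν : Measure (κ → τ → ℝ)} [IsGaussian ν] (hν : ν ≪ volume) :
    (covMatrix ν).PosDef := by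
  refine Matrix.PosDef.of_dotProduct_mulVec_pos ?_ fun u hu => ?_
  · ext a b
    simp [covMatrix, covariance_comm]
  · rw [star_trivial, ← covariance_sum_mul_eval, covariance_self
      (Measurable.aemeasurable (by fun_prop))]
    -- Zero variance would confine `ν` to an affine hyperplane, which is null for the volume.
    refine (variance_nonneg _ _).lt_of_ne' fun h0 => ?_
    let L : (κ → τ → ℝ) →ₗ[ℝ] ℝ := ∑ a : κ × τ, u a •
      (LinearMap.proj a.2 ∘ₗ (LinearMap.proj a.1 : (κ → τ → ℝ) →ₗ[ℝ] (τ → ℝ)))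
    have hL : ∀ x, L x = ∑ a, u a * x a.1 a.2 := fun x => by simp [L]
    have hmem : MemLp (fun x : κ → τ → ℝ => ∑ a : κ × τ, u a * x a.1 a.2) 2 ν :=
      memLp_finsetSum _ fun a _ => (memLp_eval a.1 a.2).const_mul _
    have hae := ae_eq_integral_of_variance_eq_zero hmem h0
    set m := ∫ x, ∑ a : κ × τ, u a * x a.1 a.2 ∂ν
    have hker : LinearMap.ker L ≠ ⊤ := by
      intro htop
      apply hu
      ext a
      have : L (Pi.single a.1 (Pi.single a.2 1)) = 0 := by
        rw [← LinearMap.mem_ker, htop]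
        trivial
      rw [hL, Finset.sum_eq_single a] at this
      · simpa using this
      · intro b _ hb
        rcases eq_or_ne b.1 a.1 with h1 | h1
        · have h2 : b.2 ≠ a.2 := fun h2 => hb (Prod.ext h1 h2)
          rw [h1]
          simp [h2]
        · simp [h1]
      · simp
    obtain ⟨x₀, hx₀⟩ : ∃ x₀, L x₀ = m := by
      obtain ⟨y, hy⟩ : ∃ y, L y ≠ 0 := by
        by_contra! h
        exact hker (by ext y; simp [h y])
      exact ⟨(m / L y) • y, by simp [hy]⟩
    have hzero : volume {x : κ → τ → ℝ | L x = m} = 0 := by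
      have h1 : {x : κ → τ → ℝ | L x = m} = (fun x => x + -x₀) ⁻¹' (LinearMap.ker L) := by
        ext x
        simp [← sub_eq_add_neg, sub_eq_zero, hx₀]
      rw [h1, measure_preimage_add_right]
      exact Measure.addHaar_submodule _ _ hker
    have h2 : ν {x | L x = m} = 0 := hν hzero
    have h3 : ∀ᵐ x ∂ν, L x = m := by
      filter_upwards [hae] with x hx
      rw [hL, hx]
    have h4 : ∀ᵐ x ∂ν, ¬ L x = m := by
      rw [ae_iff]
      simpa using h2
    have h5 : ∀ᵐ x ∂ν, False := by
      filter_upwards [h3, h4] with x hx hx'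
      exact hx' hx
    simp only [Filter.eventually_false_iff_eq_bot, ae_eq_bot] at h5
    exact IsProbabilityMeasure.ne_zero ν h5

end LawEntropy

/-! ### Entropy vectors as principal minors. -/

section Joint

variable {n T : ℕ}

/-- The entropies of the subfamilies of a jointly Gaussian family are given by the principal
minors of a positive definite matrix. -/
theorem IsJointlyGaussian.exists_posDef {Ω : Type*} [MeasurableSpace Ω] {P : Measure Ω}
    {X : Fin n → Ω → (Fin T → ℝ)} (h : IsJointlyGaussian P X) :
    (covMatrix (P.map fun ω i => X i ω)).PosDef ∧ ∀ s : Finset (Fin n),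
      differentialEntropy (P.map (subfamily X s)) = s.card * T * stdEntropy +
        Real.log ((covMatrix (P.map fun ω i => X i ω)).submatrix
          (fun a : s × Fin T => ((a.1 : Fin n), a.2))
          (fun a : s × Fin T => ((a.1 : Fin n), a.2))).det / 2 := by
  have hX := h.hasGaussianLaw
  have hG := hX.isGaussian_map
  have hpd := posDef_covMatrix h.absolutelyContinuous
  refine ⟨hpd, fun s => ?_⟩
  set ν := P.map fun ω i => X i ω with hν
  have h0 : ∀ i t, ∫ x, x i t ∂ν = 0 := by
    intro i t
    rw [hν, integral_map hX.aemeasurable (Measurable.aestronglyMeasurable (by fun_prop))]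
    have hi : Integrable (X i) P := (hX.eval i).integrable
    have := (ContinuousLinearMap.proj (R := ℝ) (φ := fun _ : Fin T => ℝ) t).integral_comp_comm hi
    rw [h.integral_eq_zero i] at this
    simpa using this
  let R : (Fin n → Fin T → ℝ) →L[ℝ] (s → Fin T → ℝ) :=
    ContinuousLinearMap.pi fun i => ContinuousLinearMap.proj (i : Fin n)
  have hR : P.map (subfamily X s) = ν.map R := by
    rw [hν, AEMeasurable.map_map_of_aemeasurable (by fun_prop) hX.aemeasurable]
    rfl
  have hcov : covMatrix (ν.map R) = (covMatrix ν).submatrix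
      (fun a : s × Fin T => ((a.1 : Fin n), a.2)) (fun a : s × Fin T => ((a.1 : Fin n), a.2)) := by
    ext a b
    simp only [covMatrix, Matrix.of_apply, Matrix.submatrix_apply]
    rw [covariance_map_fun (Measurable.aestronglyMeasurable (by fun_prop))
      (Measurable.aestronglyMeasurable (by fun_prop)) (Measurable.aemeasurable (by fun_prop))]
    rfl
  have hinj : Function.Injective fun a : s × Fin T => ((a.1 : Fin n), a.2) := by
    rintro ⟨a, t⟩ ⟨b, u⟩ hab
    simp only [Prod.mk.injEq, Subtype.val_inj] at hab
    exact Prod.ext hab.1 hab.2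
  have hpd' : (covMatrix (ν.map R)).PosDef := hcov ▸ hpd.submatrix hinj
  have hmean : ∀ (i : s) t, ∫ x, x i t ∂(ν.map R) = 0 := by
    intro i t
    rw [integral_map (by fun_prop) (Measurable.aestronglyMeasurable (by fun_prop))]
    exact h0 i t
  rw [hR, eq_gaussianLaw hmean hpd'.posSemidef, differentialEntropy_gaussianLaw hpd', hcov]
  simp

/-- Every positive definite matrix is the covariance matrix of a jointly Gaussian family. -/
theorem exists_isJointlyGaussian {S : Matrix (Fin n × Fin T) (Fin n × Fin T) ℝ} (hS : S.PosDef) :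
    ∃ (P : Measure (Fin n → Fin T → ℝ)) (X : Fin n → (Fin n → Fin T → ℝ) → (Fin T → ℝ)),
      IsJointlyGaussian P X ∧ covMatrix (P.map fun ω i => X i ω) = S := by
  have hid : (gaussianLaw S).map (fun ω (i : Fin n) => ω i) = gaussianLaw S := Measure.map_id
  refine ⟨gaussianLaw S, fun i ω => ω i, ⟨⟨?_⟩, fun i => ?_, ?_⟩, ?_⟩
  · rw [hid]
    infer_instance
  · ext t
    have hi : Integrable (fun ω : Fin n → Fin T → ℝ => ω i) (gaussianLaw S) :=
      Integrable.of_eval fun t => (memLp_eval i t).integrable (by norm_num)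
    have := (ContinuousLinearMap.proj (R := ℝ) (φ := fun _ : Fin T => ℝ) t).integral_comp_comm hi
    rw [Pi.zero_apply, ← integral_eval_gaussianLaw S i t]
    simpa using this.symm
  · rw [hid]
    exact absolutelyContinuous_gaussianLaw hS
  · rw [hid]
    ext a b
    exact covariance_eval_gaussianLaw hS.posSemidef a b

/-- This removes the probability: the rest concerns only minors of positive definite matrices. -/
theorem mem_gaussianEntropyRegionOfDim_iff {h : EntropyVector n} :
    h ∈ gaussianEntropyRegionOfDim n T ↔
      ∃ S : Matrix (Fin n × Fin T) (Fin n × Fin T) ℝ, S.PosDef ∧ ∀ s, h s =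
        (1 / (T : ℝ)) * (s.1.card * T * stdEntropy +
          Real.log (S.submatrix (fun a : s.1 × Fin T => ((a.1 : Fin n), a.2))
            (fun a : s.1 × Fin T => ((a.1 : Fin n), a.2))).det / 2) := by
  constructor
  · rintro ⟨Ω, _, P, X, hX, rfl⟩
    obtain ⟨h1, h2⟩ := hX.exists_posDef
    exact ⟨_, h1, fun s => by rw [normalizedEntropyVector, h2]⟩
  · rintro ⟨S, hS, hh⟩
    obtain ⟨P, X, hX, rfl⟩ := exists_isJointlyGaussian hS
    refine ⟨_, _, P, X, hX, funext fun s => ?_⟩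
    rw [hh, normalizedEntropyVector, hX.exists_posDef.2]

end Joint

/-! ### Submodularity of log principal minors. -/

section Minors

variable {ι : Type*} [Fintype ι] [DecidableEq ι]

/-- The logarithm of a principal minor. -/
noncomputable def logMinor (M : Matrix ι ι ℝ) (s : Finset ι) : ℝ :=
  Real.log (M.submatrix (Subtype.val : s → ι) Subtype.val).det

open Matrix in
/-- The Schur complement of a diagonal entry is the minimum of the quadratic form. -/
theorem det_submatrix_insert (M : Matrix ι ι ℝ) (hM : M.PosDef) (s : Finset ι) (i : ι)
    (hi : i ∉ s) :
    ∃ d : ℝ, 0 < d ∧ (M.submatrix (Subtype.val : ↥(insert i s) → ι) Subtype.val).det =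
        (M.submatrix (Subtype.val : s → ι) Subtype.val).det * d ∧
      (∃ x : ι → ℝ, x i = 1 ∧ (∀ j ∉ insert i s, x j = 0) ∧ x ⬝ᵥ M *ᵥ x = d) ∧
      ∀ x : ι → ℝ, x i = 1 → (∀ j ∉ insert i s, x j = 0) → d ≤ x ⬝ᵥ M *ᵥ x := by
  classical
  let f : s ⊕ Unit → ι := Sum.elim Subtype.val fun _ => i
  have hf : Function.Injective f := by
    rintro (a | a) (b | b) hab
    · exact congrArg _ (Subtype.ext hab)
    · have h : (a : ι) = i := hab
      exact (hi (h ▸ a.2)).elim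
    · have h : i = (b : ι) := hab
      exact (hi (h ▸ b.2)).elim
    · rfl
  have hrange : ∀ j, j ∈ insert i s ↔ j ∈ Set.range f := by
    intro j
    simp [f, eq_comm]
  let A : Matrix s s ℝ := M.submatrix (Subtype.val : s → ι) Subtype.val
  let B : Matrix s Unit ℝ := M.submatrix Subtype.val fun _ => i
  let D : Matrix Unit Unit ℝ := M.submatrix (fun _ => i) fun _ => i
  have hA : A.PosDef := hM.submatrix Subtype.val_injective
  have hblock : M.submatrix f f = fromBlocks A B Bᴴ D := by
    ext (a | a) (b | b)
    · rfl
    · rfl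
    · exact (congrFun (congrFun hM.isHermitian _) _).symm
    · rfl
  have : Invertible A := hA.isUnit.invertible
  let C : Matrix Unit Unit ℝ := D - Bᴴ * A⁻¹ * B
  -- Completing the square: a nonnegative form in the free coordinates plus the Schur complement.
  have hquad : ∀ x : ι → ℝ, x i = 1 → (∀ j ∉ insert i s, x j = 0) →
      x ⬝ᵥ M *ᵥ x = ((fun a : s => x a) + (A⁻¹ * B) *ᵥ fun _ => 1) ⬝ᵥ
        A *ᵥ ((fun a : s => x a) + (A⁻¹ * B) *ᵥ fun _ => 1) + C () () := by
    intro x hxi hx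
    have hx' : ∀ j ∉ Set.range f, x j = 0 := fun j hj => hx j (by rwa [hrange])
    have hsum : ∀ g : ι → ℝ, ∑ j, x j * g j = ∑ a, x (f a) * g (f a) := fun g =>
      (Fintype.sum_of_injective f hf _ _ (fun j hj => by rw [hx' j hj, zero_mul])
        fun a => rfl).symm
    have h1 : x ⬝ᵥ M *ᵥ x = (x ∘ f) ⬝ᵥ M.submatrix f f *ᵥ (x ∘ f) := by
      simp only [dotProduct, mulVec, submatrix_apply, Function.comp]
      rw [hsum]
      refine Finset.sum_congr rfl fun a _ => ?_
      congr 1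
      simp_rw [mul_comm _ (x _)]
      exact hsum _
    have h2 : x ∘ f = Sum.elim (fun a : s => x a) fun _ => 1 := by
      ext (a | a)
      · rfl
      · exact hxi
    have h3 := schur_complement_eq₁₁ B D (fun a : s => x a) (fun _ : Unit => (1 : ℝ)) hA.isHermitian
    simp only [star_trivial] at h3
    rw [h1, h2, hblock, dotProduct_mulVec, h3, dotProduct_mulVec]
    congr 1
    simp [dotProduct, vecMul, C]
  have hdet : (M.submatrix (Subtype.val : ↥(insert i s) → ι) Subtype.val).det =
      A.det * C () () := by
    let e : s ⊕ Unit ≃ ↥(insert i s) := Equiv.ofBijective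
      (fun a => ⟨f a, (hrange _).2 ⟨a, rfl⟩⟩)
      ⟨fun a b hab => hf (congrArg Subtype.val hab), fun ⟨j, hj⟩ => by
        obtain ⟨a, ha⟩ := (hrange j).1 hj
        exact ⟨a, Subtype.ext ha⟩⟩
    rw [← det_submatrix_equiv_self e, submatrix_submatrix]
    have : (Subtype.val ∘ e : s ⊕ Unit → ι) = f := rfl
    rw [this, hblock, det_fromBlocks₁₁, invOf_eq_nonsing_inv, det_unique (D - Bᴴ * A⁻¹ * B)]
  refine ⟨C () (), ?_, hdet, ?_, ?_⟩
  · have h1 : 0 < (M.submatrix (Subtype.val : ↥(insert i s) → ι) Subtype.val).det :=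
      (hM.submatrix Subtype.val_injective).det_pos
    rw [hdet] at h1
    exact pos_of_mul_pos_right h1 hA.det_pos.le
  · let y : s → ℝ := -((A⁻¹ * B) *ᵥ fun _ => 1)
    let x : ι → ℝ := fun j => if j = i then 1 else if h : j ∈ s then y ⟨j, h⟩ else 0
    have hxi : x i = 1 := by simp [x]
    have hx : ∀ j ∉ insert i s, x j = 0 := by
      intro j hj
      simp only [Finset.mem_insert, not_or] at hj
      simp [x, hj.1, hj.2]
    have hxs : (fun a : s => x a) = y := by
      ext a
      have : (a : ι) ≠ i := fun h => hi (h ▸ a.2)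
      simp [x, this]
    refine ⟨x, hxi, hx, ?_⟩
    rw [hquad x hxi hx, hxs]
    simp [y]
  · intro x hxi hx
    rw [hquad x hxi hx]
    have := hA.posSemidef.dotProduct_mulVec_nonneg
      ((fun a : s => x a) + (A⁻¹ * B) *ᵥ fun _ => 1)
    rw [star_trivial] at this
    linarith

/-- Each increment is the logarithm of a constrained minimum, and the larger set `t` admits more
competitors. -/
theorem logMinor_insert_sub_le {M : Matrix ι ι ℝ} (hM : M.PosDef) {s t : Finset ι} (hst : s ⊆ t)
    {i : ι} (hi : i ∉ t) :
    logMinor M (insert i t) - logMinor M t ≤ logMinor M (insert i s) - logMinor M s := by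
  obtain ⟨d, hd, h1, ⟨x, hx1, hx2, hx3⟩, -⟩ :=
    det_submatrix_insert M hM s i fun h => hi (hst h)
  obtain ⟨e, he, h2, -, h3⟩ := det_submatrix_insert M hM t i hi
  have hde : e ≤ d := hx3 ▸ h3 x hx1 fun j hj =>
    hx2 j fun h => hj (Finset.insert_subset_insert _ hst h)
  have hpos : ∀ u : Finset ι, 0 < (M.submatrix (Subtype.val : u → ι) Subtype.val).det :=
    fun u => (hM.submatrix Subtype.val_injective).det_pos
  simp only [logMinor, h1, h2]
  rw [Real.log_mul (hpos s).ne' hd.ne', Real.log_mul (hpos t).ne' he.ne']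
  linarith [Real.log_le_log he hde]

/-- The logarithms of the principal minors of a positive definite matrix are submodular. -/
theorem logMinor_union_add_inter_le {M : Matrix ι ι ℝ} (hM : M.PosDef) (s t : Finset ι) :
    logMinor M (s ∪ t) + logMinor M (s ∩ t) ≤ logMinor M s + logMinor M t := by
  -- Diminishing returns for adding a whole set, one element at a time; submodularity is the case `r
  -- = s \ t`, `u = s ∩ t`.
  have key : ∀ r : Finset ι, Disjoint r t → ∀ u ⊆ t,
      logMinor M (r ∪ t) - logMinor M t ≤ logMinor M (r ∪ u) - logMinor M u := by
    intro r
    induction r using Finset.induction_on with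
    | empty => intro _ u _; simp
    | insert i r hir ih =>
      intro hr u hu
      rw [Finset.disjoint_insert_left] at hr
      have h1 := ih hr.2 u hu
      have h2 := logMinor_insert_sub_le hM (Finset.union_subset_union_right (s := r) hu)
        (i := i) (by simp [hir, hr.1])
      rw [Finset.insert_union, Finset.insert_union]
      linarith
  have h := key (s \ t) Finset.sdiff_disjoint (s ∩ t) Finset.inter_subset_right
  rw [Finset.sdiff_union_self_eq_union, Finset.sdiff_union_inter] at h
  linarith

end Minors

/-! ### The submodular cone and limits of scalar averages. -/

section Region

variable {n T : ℕ}

/-- The extension of an entropy vector by the value `0` at the empty set. -/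
noncomputable def EntropyVector.extend (h : EntropyVector n) (s : Finset (Fin n)) : ℝ :=
  if hs : s.Nonempty then h ⟨s, hs⟩ else 0

/-- The cone of the submodular vectors. -/
def submodularCone (n : ℕ) : Set (EntropyVector n) :=
  {h | ∀ s t, h.extend (s ∪ t) + h.extend (s ∩ t) ≤ h.extend s + h.extend t}

theorem EntropyVector.continuous_extend (s : Finset (Fin n)) :
    Continuous fun h : EntropyVector n => h.extend s := by
  unfold EntropyVector.extend
  split_ifs <;> fun_prop

theorem isClosed_submodularCone (n : ℕ) : IsClosed (submodularCone n) := by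
  simp only [submodularCone, Set.ofPred_forall]
  exact isClosed_iInter fun s => isClosed_iInter fun t => isClosed_le
    ((EntropyVector.continuous_extend _).add (EntropyVector.continuous_extend _))
    ((EntropyVector.continuous_extend _).add (EntropyVector.continuous_extend _))

theorem convex_submodularCone (n : ℕ) : Convex ℝ (submodularCone n) := by
  intro x hx y hy a b ha hb _ s t
  have h : ∀ u : Finset (Fin n), EntropyVector.extend (a • x + b • y) u =
      a * x.extend u + b * y.extend u := by
    intro u
    unfold EntropyVector.extend
    split_ifs <;> simp
  simp only [h]
  have h1 := mul_le_mul_of_nonneg_left (hx s t) ha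
  have h2 := mul_le_mul_of_nonneg_left (hy s t) hb
  linarith

/-- The map `s ↦ s ×ˢ univ` preserves unions and intersections, so submodularity passes from minors
of `S` to blocks; the term in `stdEntropy` is modular. -/
theorem gaussianEntropyRegionOfDim_subset_submodularCone (hT : 1 ≤ T) :
    gaussianEntropyRegionOfDim n T ⊆ submodularCone n := by
  intro h hh
  obtain ⟨S, hS, hs⟩ := mem_gaussianEntropyRegionOfDim_iff.1 hh
  have hT' : (T : ℝ) ≠ 0 := by positivity
  have key : ∀ s, h.extend s = s.card * stdEntropy +
      logMinor S (s ×ˢ (Finset.univ : Finset (Fin T))) / (2 * T) := by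
    intro s
    unfold EntropyVector.extend
    split_ifs with hne
    · let e : s × Fin T ≃ ↥(s ×ˢ (Finset.univ : Finset (Fin T))) :=
        { toFun := fun a => ⟨(a.1, a.2), by simp⟩
          invFun := fun a => (⟨a.1.1, (Finset.mem_product.1 a.2).1⟩, a.1.2)
          left_inv := fun _ => rfl
          right_inv := fun _ => rfl }
      rw [hs, logMinor, ← Matrix.det_submatrix_equiv_self e, Matrix.submatrix_submatrix]
      change (1 / (T : ℝ)) * (s.card * T * stdEntropy + Real.log (S.submatrix
        (fun a : s × Fin T => ((a.1 : Fin n), a.2))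
        (fun a : s × Fin T => ((a.1 : Fin n), a.2))).det / 2) = s.card * stdEntropy +
        Real.log (S.submatrix (fun a : s × Fin T => ((a.1 : Fin n), a.2))
        (fun a : s × Fin T => ((a.1 : Fin n), a.2))).det / (2 * T)
      field_simp
    -- The empty minor is 1, with logarithm 0, matching the value of `extend` at the empty set.
    · rw [Finset.not_nonempty_iff_eq_empty] at hne
      subst hne
      have : IsEmpty ↥((∅ : Finset (Fin n)) ×ˢ (Finset.univ : Finset (Fin T))) := by
        rw [Finset.empty_product]
        infer_instance
      rw [logMinor, Matrix.det_isEmpty]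
      simp
  intro s t
  have h1 := logMinor_union_add_inter_le hS (s ×ˢ (Finset.univ : Finset (Fin T)))
    (t ×ˢ (Finset.univ : Finset (Fin T)))
  rw [← Finset.union_product, ← Finset.inter_product] at h1
  have h2 : ((s ∪ t).card : ℝ) + (s ∩ t).card = s.card + t.card := by
    exact_mod_cast Finset.card_union_add_card_inter s t
  have h3 := div_le_div_of_nonneg_right h1 (by positivity : (0 : ℝ) ≤ 2 * T)
  rw [add_div, add_div] at h3
  simp only [key]
  linear_combination h3 + stdEntropy * h2

/-- The entropy vector of scalar Gaussian variables with covariance matrix `M`. -/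
noncomputable def scalarEntropyVector (M : Matrix (Fin n) (Fin n) ℝ) : EntropyVector n :=
  fun s => s.1.card * stdEntropy + logMinor M s.1 / 2

theorem posDef_blockDiagonal {m o : Type*} [Fintype m] [Fintype o] [DecidableEq o]
    {M : o → Matrix m m ℝ} (hM : ∀ t, (M t).PosDef) : (Matrix.blockDiagonal M).PosDef := by
  refine Matrix.PosDef.of_dotProduct_mulVec_pos ?_ fun x hx => ?_
  · rw [Matrix.IsHermitian, Matrix.blockDiagonal_conjTranspose]
    exact congrArg _ (funext fun t => (hM t).isHermitian)
  · have h : star x ⬝ᵥ (Matrix.blockDiagonal M).mulVec x =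
        ∑ t, (fun i => x (i, t)) ⬝ᵥ (M t).mulVec fun i => x (i, t) := by
      simp only [dotProduct, Matrix.mulVec, Matrix.blockDiagonal_apply, Fintype.sum_prod_type,
        star_trivial]
      rw [Finset.sum_comm]
      simp
    rw [h]
    obtain ⟨⟨i, t⟩, hit⟩ := Function.ne_iff.1 hx
    refine Finset.sum_pos' (fun t _ => ?_) ⟨t, Finset.mem_univ _, ?_⟩
    · simpa using (hM t).posSemidef.dotProduct_mulVec_nonneg fun i => x (i, t)
    · simpa using (hM t).dotProduct_mulVec_pos (x := fun i => x (i, t))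
        fun h => hit (congrFun h i)

/-- Independent scalar families can be stacked into a vector-valued one. -/
theorem average_mem_gaussianEntropyRegionOfDim (hT : 1 ≤ T)
    {M : Fin T → Matrix (Fin n) (Fin n) ℝ} (hM : ∀ t, (M t).PosDef) :
    (1 / (T : ℝ)) • ∑ t, scalarEntropyVector (M t) ∈ gaussianEntropyRegionOfDim n T := by
  have hT' : (T : ℝ) ≠ 0 := by positivity
  refine mem_gaussianEntropyRegionOfDim_iff.2
    ⟨Matrix.blockDiagonal M, posDef_blockDiagonal hM, fun s => ?_⟩
  have h1 : (Matrix.blockDiagonal M).submatrix (fun a : s.1 × Fin T => ((a.1 : Fin n), a.2))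
      (fun a : s.1 × Fin T => ((a.1 : Fin n), a.2)) =
      Matrix.blockDiagonal fun t => (M t).submatrix (Subtype.val : s.1 → Fin n) Subtype.val := by
    ext a b
    simp [Matrix.blockDiagonal_apply]
  rw [h1, Matrix.det_blockDiagonal, Real.log_prod fun t _ =>
    ((hM t).submatrix Subtype.val_injective).det_pos.ne']
  simp only [scalarEntropyVector, logMinor, Pi.smul_apply, Finset.sum_apply, smul_eq_mul,
    Finset.sum_add_distrib, Finset.sum_const, Finset.card_univ, Fintype.card_fin, nsmul_eq_mul,
    Finset.sum_div]
  ring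

theorem scalarEntropyVector_mem {M : Matrix (Fin n) (Fin n) ℝ} (hM : M.PosDef) :
    scalarEntropyVector M ∈ scalarGaussianEntropyRegion n := by
  have := average_mem_gaussianEntropyRegionOfDim (T := 1) le_rfl (M := fun _ => M) fun _ => hM
  simpa [scalarGaussianEntropyRegion] using this

/-- The averages of finitely many entropy vectors of scalar Gaussian families. -/
def scalarAverages (n : ℕ) : Set (EntropyVector n) :=
  {h | ∃ T : ℕ, 1 ≤ T ∧ ∃ M : Fin T → Matrix (Fin n) (Fin n) ℝ, (∀ t, (M t).PosDef) ∧
    h = (1 / (T : ℝ)) • ∑ t, scalarEntropyVector (M t)}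

theorem scalarAverages_subset_vectorGaussianEntropyRegion :
    scalarAverages n ⊆ vectorGaussianEntropyRegion n := by
  rintro _ ⟨T, hT, M, hM, rfl⟩
  exact ⟨T, hT, average_mem_gaussianEntropyRegionOfDim hT hM⟩

theorem scalarAverages_subset_convexHull :
    scalarAverages n ⊆ convexHull ℝ (scalarGaussianEntropyRegion n) := by
  rintro _ ⟨T, hT, M, hM, rfl⟩
  have hT' : (T : ℝ) ≠ 0 := by positivity
  rw [Finset.smul_sum]
  exact (convex_convexHull ℝ _).sum_mem (fun _ _ => by positivity) (by simp [hT'])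
    fun t _ => subset_convexHull _ _ (scalarEntropyVector_mem (hM t))

/-- `k` is an asymptotic direction of the scalar region: the ray `-r k` stays at a bounded
distance from it. -/
def IsAsymptoticDirection (k : EntropyVector n) : Prop :=
  ∃ C : ℝ, ∀ r : ℝ, 0 ≤ r → ∃ M : Matrix (Fin n) (Fin n) ℝ, M.PosDef ∧
    ∀ s, |scalarEntropyVector M s + r * k s| ≤ C

theorem sub_sum_mem_closure_scalarAverages {m : ℕ} {M₀ : Matrix (Fin n) (Fin n) ℝ}
    (hM₀ : M₀.PosDef) {k : Fin m → EntropyVector n} (hk : ∀ d, IsAsymptoticDirection (k d))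
    {r : Fin m → ℝ} (hr : ∀ d, 0 ≤ r d) :
    scalarEntropyVector M₀ - ∑ d, r d • k d ∈ closure (scalarAverages n) := by
  choose C hC using hk
  choose M hM hMC using fun (N : ℕ) d => hC d (r d * N) (mul_nonneg (hr d) N.cast_nonneg)
  set h := scalarEntropyVector M₀ - ∑ d, r d • k d with hh
  -- `N + 1` copies of `M₀` and one matrix per direction, pushed out to distance `r d * (N + 1)`:
  -- after averaging, both parts have comparable weight.
  let u : ℕ → EntropyVector n := fun N => (1 / ((N + 1 + m : ℕ) : ℝ)) •
    ∑ t, scalarEntropyVector ((Fin.append (fun _ => M₀) (M (N + 1)) :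
      Fin (N + 1 + m) → Matrix (Fin n) (Fin n) ℝ) t)
  have hu : ∀ N, u N ∈ scalarAverages n := fun N => by
    refine ⟨N + 1 + m, by omega, _, fun t => ?_, rfl⟩
    refine Fin.addCases (fun i => ?_) (fun i => ?_) t
    · rw [Fin.append_left]
      exact hM₀
    · rw [Fin.append_right]
      exact hM _ _
  refine mem_closure_of_tendsto (f := u) (b := Filter.atTop) (tendsto_pi_nhds.2 fun s => ?_)
    (Filter.Eventually.of_forall hu)
  have hbound : ∀ N : ℕ, |u N s - h s| ≤ (∑ d, C d + m * |h s|) * (1 / ((N : ℝ) + 1)) := by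
    intro N
    have hpos : (0 : ℝ) < (N : ℝ) + 1 + m := by positivity
    -- The total deviation from the rays, bounded independently of `N`.
    set e : ℝ := ∑ d, (scalarEntropyVector (M (N + 1) d) s + r d * (N + 1 : ℕ) * k d s) with he
    have hue : u N s = (((N : ℝ) + 1) * h s + e) / ((N : ℝ) + 1 + m) := by
      simp only [u, Fin.sum_univ_add, Fin.append_left, Fin.append_right, Pi.smul_apply,
        Pi.add_apply, Finset.sum_apply, smul_eq_mul, Finset.sum_const, Finset.card_univ,
        Fintype.card_fin, nsmul_eq_mul, hh, Pi.sub_apply, he, Finset.sum_add_distrib, Pi.mul_apply, Pi.natCast_apply]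
      have : ∑ d, r d * ((N + 1 : ℕ) : ℝ) * k d s = ((N : ℝ) + 1) * ∑ d, r d * k d s := by
        rw [Finset.mul_sum]
        push_cast
        exact Finset.sum_congr rfl fun d _ => by ring
      rw [this]
      push_cast
      ring
    have hsub : u N s - h s = (e - m * h s) / ((N : ℝ) + 1 + m) := by
      rw [hue]
      field_simp
      ring
    have he' : |e| ≤ ∑ d, C d := (Finset.abs_sum_le_sum_abs _ _).trans
      (Finset.sum_le_sum fun d _ => hMC (N + 1) d s)
    have hnum : |e - m * h s| ≤ ∑ d, C d + m * |h s| := by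
      refine (abs_sub _ _).trans ?_
      rw [abs_mul, Nat.abs_cast]
      linarith
    rw [hsub, abs_div, abs_of_pos hpos, div_eq_mul_one_div]
    refine mul_le_mul hnum ?_ (by positivity) ((abs_nonneg _).trans hnum)
    exact one_div_le_one_div_of_le (by positivity) (by linarith [(Nat.cast_nonneg m : (0:ℝ) ≤ m)])
  rw [tendsto_iff_norm_sub_tendsto_zero]
  refine squeeze_zero (fun _ => norm_nonneg _) hbound ?_
  simpa using tendsto_one_div_add_atTop_nhds_zero_nat.const_mul (∑ d, C d + m * |h s|)

/-- Scalar Gaussian families with covariance matrix `G + δ` for `δ → 0`. -/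
theorem isAsymptoticDirection_of_posSemidef {G : Matrix (Fin n) (Fin n) ℝ} (hG : G.PosSemidef)
    (k : {s : Finset (Fin n) // s.Nonempty} → ℕ) {C : ℝ}
    (hk : ∀ δ : ℝ, 0 < δ → δ ≤ 1 → ∀ s,
      δ ^ k s ≤ ((G + δ • (1 : Matrix (Fin n) (Fin n) ℝ)).submatrix
        (Subtype.val : s.1 → Fin n) Subtype.val).det ∧
      ((G + δ • (1 : Matrix (Fin n) (Fin n) ℝ)).submatrix
        (Subtype.val : s.1 → Fin n) Subtype.val).det ≤ C * δ ^ k s) :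
    IsAsymptoticDirection fun s => (k s : ℝ) := by
  refine ⟨n * |stdEntropy| + |Real.log C| / 2, fun r hr => ?_⟩
  -- Chosen so that half the logarithm of `δ ^ k s` is `-r * k s`.
  set δ := Real.exp (-(2 * r)) with hδ
  have hδ0 : 0 < δ := Real.exp_pos _
  have hδ1 : δ ≤ 1 := Real.exp_le_one_iff.2 (by linarith)
  refine ⟨G + δ • 1, Matrix.PosDef.posSemidef_add hG (Matrix.PosDef.one.smul hδ0), fun s => ?_⟩
  obtain ⟨h1, h2⟩ := hk δ hδ0 hδ1 s
  have hpow : 0 < δ ^ k s := by positivity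
  have hCpos : 0 < C := pos_of_mul_pos_left (hpow.trans_le (h1.trans h2)) hpow.le
  have hlog : Real.log (δ ^ k s) = -(2 * (r * k s)) := by
    rw [Real.log_pow, hδ, Real.log_exp]
    ring
  have h3 := Real.log_le_log hpow h1
  have h4 := Real.log_le_log (hpow.trans_le h1) h2
  rw [Real.log_mul hCpos.ne' hpow.ne'] at h4
  rw [hlog] at h3 h4
  have h5 : |logMinor (G + δ • 1) s.1 / 2 + r * k s| ≤ |Real.log C| / 2 := by
    rw [logMinor, abs_le]
    have := le_abs_self (Real.log C)
    have := abs_nonneg (Real.log C)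
    constructor <;> linarith
  have h6 : |(s.1.card : ℝ) * stdEntropy| ≤ n * |stdEntropy| := by
    rw [abs_mul, Nat.abs_cast]
    refine mul_le_mul_of_nonneg_right ?_ (abs_nonneg _)
    exact_mod_cast (Finset.card_le_univ s.1).trans_eq (Fintype.card_fin n)
  rw [scalarEntropyVector, add_assoc]
  exact (abs_add_le _ _).trans (add_le_add h6 h5)

/-- Independent scalar Gaussian variables realize every modular vector. -/
theorem exists_scalarEntropyVector_eq_sum (a : Fin n → ℝ) :
    ∃ M : Matrix (Fin n) (Fin n) ℝ, M.PosDef ∧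
      ∀ s, scalarEntropyVector M s = ∑ i ∈ s.1, a i := by
  -- The variance for which the `i`-th variable has entropy exactly `a i`.
  refine ⟨Matrix.diagonal fun i => Real.exp (2 * (a i - stdEntropy)),
    Matrix.PosDef.diagonal fun i => Real.exp_pos _, fun s => ?_⟩
  rw [scalarEntropyVector, logMinor, Matrix.submatrix_diagonal _ _ Subtype.val_injective,
    Matrix.det_diagonal]
  simp only [Function.comp]
  rw [Real.log_prod fun i _ => (Real.exp_pos _).ne']
  simp only [Real.log_exp]
  rw [Finset.sum_coe_sort s.1 fun i => 2 * (a i - stdEntropy), ← Finset.mul_sum,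
    Finset.sum_sub_distrib]
  simp

end Region

/-! ### Three variables: the five directions and the decomposition. -/

section Three

/-- A principal minor, with its rows and columns enumerated. -/
theorem det_submatrix_val_eq {ι : Type*} [DecidableEq ι] (M : Matrix ι ι ℝ) {s : Finset ι} {m : ℕ}
    (f : Fin m → ι) (hf : Function.Injective f) (hs : s = Finset.univ.image f) :
    (M.submatrix (Subtype.val : s → ι) Subtype.val).det = (M.submatrix f f).det := by
  let e : Fin m ≃ s := Equiv.ofBijective (fun a => ⟨f a, by simp [hs]⟩)
    ⟨fun a b hab => hf (congrArg Subtype.val hab), fun ⟨j, hj⟩ => by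
      obtain ⟨a, -, ha⟩ := Finset.mem_image.1 (hs ▸ hj)
      exact ⟨a, Subtype.ext ha⟩⟩
  rw [← Matrix.det_submatrix_equiv_self e, Matrix.submatrix_submatrix]
  rfl

theorem nonempty_finset_fin_three {s : Finset (Fin 3)} (hs : s.Nonempty) :
    s = {0} ∨ s = {1} ∨ s = {2} ∨ s = {0, 1} ∨ s = {0, 2} ∨ s = {1, 2} ∨ s = {0, 1, 2} := by
  revert s
  decide

theorem det_minor_singleton {ι : Type*} [DecidableEq ι] (M : Matrix ι ι ℝ) (i : ι) :
    (M.submatrix (Subtype.val : ({i} : Finset ι) → ι) Subtype.val).det = M i i := by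
  rw [det_submatrix_val_eq M ![i] (Function.injective_of_subsingleton _)
    (by simp), Matrix.det_fin_one]
  rfl

theorem det_minor_pair {ι : Type*} [DecidableEq ι] (M : Matrix ι ι ℝ) {i j : ι} (hij : i ≠ j) :
    (M.submatrix (Subtype.val : ({i, j} : Finset ι) → ι) Subtype.val).det =
      M i i * M j j - M i j * M j i := by
  rw [det_submatrix_val_eq M ![i, j] ?_ ?_, Matrix.det_fin_two]
  · rfl
  · intro a b
    fin_cases a <;> fin_cases b <;> simp [hij, hij.symm]
  · ext x
    simp [Fin.exists_fin_two, eq_comm]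

/-- A property of the principal minors of a `3 × 3` matrix, in terms of the entries. -/
theorem forall_minor_of_entries {G : Matrix (Fin 3) (Fin 3) ℝ}
    {k : {s : Finset (Fin 3) // s.Nonempty} → ℕ} (Q : ℝ → ℕ → Prop)
    (h0 : Q (G 0 0) (k ⟨{0}, by simp⟩)) (h1 : Q (G 1 1) (k ⟨{1}, by simp⟩))
    (h2 : Q (G 2 2) (k ⟨{2}, by simp⟩))
    (h01 : Q (G 0 0 * G 1 1 - G 0 1 * G 1 0) (k ⟨{0, 1}, by simp⟩))
    (h02 : Q (G 0 0 * G 2 2 - G 0 2 * G 2 0) (k ⟨{0, 2}, by simp⟩))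
    (h12 : Q (G 1 1 * G 2 2 - G 1 2 * G 2 1) (k ⟨{1, 2}, by simp⟩))
    (h012 : Q G.det (k ⟨{0, 1, 2}, by simp⟩)) (s : {s : Finset (Fin 3) // s.Nonempty}) :
    Q (G.submatrix (Subtype.val : s.1 → Fin 3) Subtype.val).det (k s) := by
  obtain ⟨s, hs⟩ := s
  rcases nonempty_finset_fin_three hs with rfl | rfl | rfl | rfl | rfl | rfl | rfl
  · exact (det_minor_singleton G 0).symm ▸ h0
  · exact (det_minor_singleton G 1).symm ▸ h1
  · exact (det_minor_singleton G 2).symm ▸ h2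
  · exact (det_minor_pair G (by decide : (0 : Fin 3) ≠ 1)).symm ▸ h01
  · exact (det_minor_pair G (by decide : (0 : Fin 3) ≠ 2)).symm ▸ h02
  · exact (det_minor_pair G (by decide : (1 : Fin 3) ≠ 2)).symm ▸ h12
  · have h : ({0, 1, 2} : Finset (Fin 3)) = Finset.univ.image id := by decide
    exact (det_submatrix_val_eq G id Function.injective_id h).symm ▸ h012

/-- The direction of `X₂ = X₀ + X₁ + ε Z`. -/
theorem isAsymptoticDirection_univ : IsAsymptoticDirection
    fun s : {s : Finset (Fin 3) // s.Nonempty} => ((if s.1 = {0, 1, 2} then 1 else 0 : ℕ) : ℝ) := by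
  have hG : (!![1, 0, 1; 0, 1, 1; 1, 1, 2] : Matrix (Fin 3) (Fin 3) ℝ).PosSemidef := by
    have := Matrix.posSemidef_self_mul_conjTranspose (!![1, 0; 0, 1; 1, 1] : Matrix _ _ ℝ)
    convert this using 1
    ext i j
    fin_cases i <;> fin_cases j <;> simp [Matrix.mul_apply, Fin.sum_univ_two] <;> norm_num
  -- The full determinant is `δ * (1 + δ) * (3 + δ)`, at most `8 * δ` for `δ ≤ 1`; the same constant
  -- suffices for the other directions.
  refine isAsymptoticDirection_of_posSemidef hG _ (C := 8) fun δ h0 h1 => ?_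
  have : δ ^ 2 ≤ 1 := by nlinarith
  refine forall_minor_of_entries (fun x m => δ ^ m ≤ x ∧ x ≤ 8 * δ ^ m) ?_ ?_ ?_ ?_ ?_ ?_ ?_ <;>
    simp [Matrix.det_fin_three, Finset.ext_iff, Fin.forall_fin_succ] <;>
    constructor <;> nlinarith [mul_pos h0 h0, mul_pos h0 (mul_pos h0 h0)]

/-- The direction of `X₁ = X₀ + ε Z`, `X₂ = X₀ + ε Z'`. -/
theorem isAsymptoticDirection_card : IsAsymptoticDirection
    fun s : {s : Finset (Fin 3) // s.Nonempty} => ((s.1.card - 1 : ℕ) : ℝ) := by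
  have hG : (!![1, 1, 1; 1, 1, 1; 1, 1, 1] : Matrix (Fin 3) (Fin 3) ℝ).PosSemidef := by
    have := Matrix.posSemidef_self_mul_conjTranspose (!![1; 1; 1] : Matrix _ _ ℝ)
    convert this using 1
    ext i j
    fin_cases i <;> fin_cases j <;> simp [Matrix.mul_apply]
  refine isAsymptoticDirection_of_posSemidef hG _ (C := 8) fun δ h0 h1 => ?_
  have : δ ^ 2 ≤ 1 := by nlinarith
  refine forall_minor_of_entries (fun x m => δ ^ m ≤ x ∧ x ≤ 8 * δ ^ m) ?_ ?_ ?_ ?_ ?_ ?_ ?_ <;>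
    simp [Matrix.det_fin_three] <;>
    constructor <;> nlinarith [mul_pos h0 h0, mul_pos h0 (mul_pos h0 h0)]

/-- The direction of `X_j = X_i + ε Z`, with the third variable independent of both. -/
theorem isAsymptoticDirection_pair (l : Fin 3) : IsAsymptoticDirection
    fun s : {s : Finset (Fin 3) // s.Nonempty} =>
      ((if ∀ i, i ≠ l → i ∈ s.1 then 1 else 0 : ℕ) : ℝ) := by
  have hG : (Matrix.of fun i j => if (i = l ↔ j = l) then 1 else 0 :
      Matrix (Fin 3) (Fin 3) ℝ).PosSemidef := by
    have := Matrix.posSemidef_self_mul_conjTranspose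
      (Matrix.of fun i j => if (i = l ↔ j = 0) then 1 else 0 : Matrix (Fin 3) (Fin 2) ℝ)
    convert this using 1
    ext i j
    by_cases hi : i = l <;> by_cases hj : j = l <;> simp [Matrix.mul_apply, Fin.sum_univ_two, hi, hj]
  refine isAsymptoticDirection_of_posSemidef hG _ (C := 8) fun δ h0 h1 => ?_
  have : δ ^ 2 ≤ 1 := by nlinarith
  fin_cases l <;>
  refine forall_minor_of_entries (fun x m => δ ^ m ≤ x ∧ x ≤ 8 * δ ^ m) ?_ ?_ ?_ ?_ ?_ ?_ ?_ <;>
    simp [Matrix.det_fin_three, Fin.forall_fin_succ] <;>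
    constructor <;> nlinarith [mul_pos h0 h0, mul_pos h0 (mul_pos h0 h0)]

/-- Subtracting the modular vector of singleton values leaves four deficits: the mutual information
`p l` of the pair omitting `l`, and the total correlation `q`. They must be matched by nonnegative
multiples of the five directions. -/
theorem submodularCone_three_subset : submodularCone 3 ⊆ closure (scalarAverages 3) := by
  intro h hh
  set a : Fin 3 → ℝ := fun i => h.extend {i} with ha
  set p : Fin 3 → ℝ := fun l => ∑ i ∈ {l}ᶜ, a i - h.extend {l}ᶜ with hp
  set q : ℝ := ∑ i, a i - h.extend Finset.univ with hq
  have hempty : h.extend ∅ = 0 := by simp [EntropyVector.extend]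
  have c0 : ({0}ᶜ : Finset (Fin 3)) = {1, 2} := by decide
  have c1 : ({1}ᶜ : Finset (Fin 3)) = {0, 2} := by decide
  have c2 : ({2}ᶜ : Finset (Fin 3)) = {0, 1} := by decide
  have cu : (Finset.univ : Finset (Fin 3)) = {0, 1, 2} := by decide
  have u0 : ({1} ∪ {2} : Finset (Fin 3)) = {1, 2} ∧ ({1} ∩ {2} : Finset (Fin 3)) = ∅ := by decide
  have u1 : ({0} ∪ {2} : Finset (Fin 3)) = {0, 2} ∧ ({0} ∩ {2} : Finset (Fin 3)) = ∅ := by decide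
  have u2 : ({0} ∪ {1} : Finset (Fin 3)) = {0, 1} ∧ ({0} ∩ {1} : Finset (Fin 3)) = ∅ := by decide
  have v0 : ({0, 1} ∪ {0, 2} : Finset (Fin 3)) = {0, 1, 2} ∧
    ({0, 1} ∩ {0, 2} : Finset (Fin 3)) = {0} := by decide
  have v1 : ({0, 1} ∪ {1, 2} : Finset (Fin 3)) = {0, 1, 2} ∧
    ({0, 1} ∩ {1, 2} : Finset (Fin 3)) = {1} := by decide
  have v2 : ({0, 2} ∪ {1, 2} : Finset (Fin 3)) = {0, 1, 2} ∧
    ({0, 2} ∩ {1, 2} : Finset (Fin 3)) = {2} := by decide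
  have p0 : p 0 = a 1 + a 2 - h.extend {1, 2} := by simp [hp, c0]
  have p1 : p 1 = a 0 + a 2 - h.extend {0, 2} := by simp [hp, c1]
  have p2 : p 2 = a 0 + a 1 - h.extend {0, 1} := by simp [hp, c2]
  have q' : q = a 0 + a 1 + a 2 - h.extend {0, 1, 2} := by rw [hq, Fin.sum_univ_three, cu]
  have hp0 : 0 ≤ p 0 := by
    have := hh {1} {2}
    rw [u0.1, u0.2, hempty] at this
    simp only [p0, ha]; linarith
  have hp1 : 0 ≤ p 1 := by
    have := hh {0} {2}
    rw [u1.1, u1.2, hempty] at this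
    simp only [p1, ha]; linarith
  have hp2 : 0 ≤ p 2 := by
    have := hh {0} {1}
    rw [u2.1, u2.2, hempty] at this
    simp only [p2, ha]; linarith
  -- Nonnegativity of the conditional mutual information of 1 and 2 given 0.
  have hq0 : p 1 + p 2 ≤ q := by
    have := hh {0, 1} {0, 2}
    rw [v0.1, v0.2] at this
    simp only [p1, p2, q', ha]; linarith
  have hq1 : p 0 + p 2 ≤ q := by
    have := hh {0, 1} {1, 2}
    rw [v1.1, v1.2] at this
    simp only [p0, p2, q', ha]; linarith
  have hq2 : p 0 + p 1 ≤ q := by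
    have := hh {0, 2} {1, 2}
    rw [v2.1, v2.2] at this
    simp only [p0, p1, q', ha]; linarith
  -- `m` is the least of the `p l`; the last inequality says that `q` is at least the sum of the
  -- other two.
  obtain ⟨m, hm, hm0, hm1, hm2, hmq⟩ : ∃ m, 0 ≤ m ∧ m ≤ p 0 ∧ m ≤ p 1 ∧ m ≤ p 2 ∧
      0 ≤ q - (p 0 + p 1 + p 2) + m := by
    rcases le_total (p 0) (p 1) with h1 | h1 <;> rcases le_total (p 0) (p 2) with h2 | h2 <;>
      rcases le_total (p 1) (p 2) with h3 | h3
    all_goals first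
      | exact ⟨p 0, by assumption, by linarith, by linarith, by linarith, by linarith⟩
      | exact ⟨p 1, by assumption, by linarith, by linarith, by linarith, by linarith⟩
      | exact ⟨p 2, by assumption, by linarith, by linarith, by linarith, by linarith⟩
  obtain ⟨M, hM, hMs⟩ := exists_scalarEntropyVector_eq_sum a
  -- On the pair omitting `l` the deficit is `(p l - m) + m`. On the triple, the pair directions
  -- give the sum of the `p l` minus `3 * m` and the cardinality direction gives `2 * m`, so the
  -- last coefficient makes up the rest of `q`.
  have key := sub_sum_mem_closure_scalarAverages hM
    (k := Fin.append (fun l => fun s => ((if ∀ i, i ≠ l → i ∈ s.1 then 1 else 0 : ℕ) : ℝ))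
      ![fun s => ((if s.1 = {0, 1, 2} then 1 else 0 : ℕ) : ℝ), fun s => ((s.1.card - 1 : ℕ) : ℝ)])
    (r := Fin.append (fun l => p l - m) ![q - (p 0 + p 1 + p 2) + m, m])
    (fun d => by
      refine Fin.addCases (fun l => ?_) (fun l => ?_) d
      · rw [Fin.append_left]
        exact isAsymptoticDirection_pair l
      · rw [Fin.append_right]
        fin_cases l
        · exact isAsymptoticDirection_univ
        · exact isAsymptoticDirection_card)
    (fun d => by
      refine Fin.addCases (fun l => ?_) (fun l => ?_) d
      · rw [Fin.append_left]
        fin_cases l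
        · exact sub_nonneg.2 hm0
        · exact sub_nonneg.2 hm1
        · exact sub_nonneg.2 hm2
      · rw [Fin.append_right]
        fin_cases l
        · exact hmq
        · exact hm)
  convert key using 1
  ext s
  have hs : h s = h.extend s.1 := by simp [EntropyVector.extend, s.2]
  rw [Pi.sub_apply, hMs, Finset.sum_apply, Fin.sum_univ_add, hs]
  simp only [Fin.append_left, Fin.append_right, Pi.smul_apply, smul_eq_mul, Fin.sum_univ_three,
    Fin.sum_univ_two, Matrix.cons_val_zero, Matrix.cons_val_one]
  obtain ⟨s, hne⟩ := s
  clear hs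
  rcases nonempty_finset_fin_three hne with rfl | rfl | rfl | rfl | rfl | rfl | rfl <;>
    simp [Fin.forall_fin_succ, Finset.ext_iff, p0, p1, p2, q'] <;> simp [ha] <;> ring

end Three

theorem theorem2 :
    closure (vectorGaussianEntropyRegion 3) =
      closure (convexHull ℝ (scalarGaussianEntropyRegion 3)) := by
  have hV : vectorGaussianEntropyRegion 3 ⊆ submodularCone 3 := by
    rintro h ⟨T, hT, hh⟩
    exact gaussianEntropyRegionOfDim_subset_submodularCone hT hh
  have hS : convexHull ℝ (scalarGaussianEntropyRegion 3) ⊆ submodularCone 3 :=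
    convexHull_min (gaussianEntropyRegionOfDim_subset_submodularCone le_rfl)
      (convex_submodularCone 3)
  refine Set.Subset.antisymm ?_ ?_
  · exact (closure_minimal hV (isClosed_submodularCone 3)).trans
      (submodularCone_three_subset.trans (closure_mono scalarAverages_subset_convexHull))
  · exact (closure_minimal hS (isClosed_submodularCone 3)).trans
      (submodularCone_three_subset.trans
        (closure_mono scalarAverages_subset_vectorGaussianEntropyRegion))
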